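/- Let $M$ be a smooth manifold and $E\to M$ a real vector bundle of finite rank. Let $\mathfrak{D}E$ be its gauge Lie algebroid, whose fibre at $x$ consists of the pairs $(X,\delta)$ of $X\in T_xM$ and a linear map $\delta:\Gamma(E)\to E_x$ with $\delta(fu)=f(x)\delta(u)+X(f)u(x)$. Write $\mathbbm{j}:\mathfrak{D}E\to TM$, $(X,\delta)\mapsto X$, for the symbol map, and $[\cdot,\cdot]_{\mathfrak{D}}$ for the commutator bracket. Let $\mathfrak{J}E$ be the first jet bundle, identified with the bundle $\{\nu\in\mathrm{Hom}(\mathfrak{D}E,E)\mid \nu(\Phi)=\Phi(\nu(\mathrm{id}_E))\ \forall\,\Phi\in\mathrm{gl}(E)\}$, and let $\mathbbm{d}:\Gamma(E)\to\Gamma(\mathfrak{J}E)$ be given by $\mathbbm{d}u(\delta)=\delta(u)$. An $E$-Courant algebroid is a finite rank vector bundle $\mathcal{K}\to M$ with an $\mathbb{R}$-bilinear bracket $[\cdot,\cdot]_{\mathcal{K}}$ on $\Gamma(\mathcal{K})$ satisfying $[X,[Y,Z]_{\mathcal K}]_{\mathcal K}=[[X,Y]_{\mathcal K},Z]_{\mathcal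 K}+[Y,[X,Z]_{\mathcal K}]_{\mathcal K}$, a nondegenerate symmetric bilinear bundle map $(\cdot,\cdot)_E:\mathcal{K}\otimes\mathcal{K}\to E$, by which $\mathcal{K}$ is embedded in $\mathrm{Hom}(\mathcal{K},E)$ via $Y(X)=2(X,Y)_E$, and a bundle map $\rho:\mathcal{K}\to\mathfrak{D}E$ with $E$-dual $\rho^\star(\nu)(X)=\nu(\rho(X))$, such that for all $X,Y,Z\in\Gamma(\mathcal{K})$: $\rho[X,Y]_{\mathcal{K}}=[\rho(X),\rho(Y)]_{\mathfrak{D}}$; $[X,X]_{\mathcal{K}}=\rho^\star\mathbbm{d}(X,X)_E$; $\rho(X)(Y,Z)_E=([X,Y]_{\mathcal{K}},Z)_E+(Y,[X,Z]_{\mathcal{K}})_E$; $\rho^\star(\mathfrak{J}E)\subset\mathcal{K}$; and $\rho\circ\rho^\star=0$ on $\mathfrak{J}E$. A generalized complex structure on $\mathcal{K}$ is a bundle map $\mathcal{J}:\mathcal{K}\to\mathcal{K}$ with $\mathcal{J}^2=-1$, $(\mathcal{J}X,\mathcal{J}Y)_E=(X,Y)_E$ and $[\mathcal{J}X,\mathcal{J}Y]_{\mathcal{K}}-[X,Y]_{\mathcal{K}}-\mathcal{J}([\mathcal{J}X,Y]_{\mathcal{K}}+[X,\mathcal{J}Y]_{\mathcal{K}})=0$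 for all $X,Y\in\Gamma(\mathcal{K})$. **Theorem.** Let $\mathcal{J}$ be a generalized complex structure on an $E$-Courant algebroid $\mathcal{K}$. Then $$[u,v]_E:=2(\mathcal{J}\rho^\star\mathbbm{d}u,\rho^\star\mathbbm{d}v)_E=(\rho\circ\mathcal{J}\circ\rho^\star)(\mathbbm{d}u)(v),\qquad u,v\in\Gamma(E),$$ defines an alternating $\mathbb{R}$-bilinear bracket $\Gamma(E)\times\Gamma(E)\to\Gamma(E)$. If $\operatorname{rank}E\ge 2$, then $u\mapsto\mathbbm{j}\rho\mathcal{J}\rho^\star\mathbbm{d}u$ is induced by a smooth bundle map $a:E\to TM$, and $(E,[\cdot,\cdot]_E,a)$ is a Lie algebroid: $[\cdot,\cdot]_E$ is a Lie bracket, $[u,fv]_E=f[u,v]_E+a(u)(f)\,v$ and $a([u,v]_E)=[a(u),a(v)]$ for $u,v\in\Gamma(E)$, $f\in C^\infty(M)$. If $\operatorname{rank}E=1$, then $(E,[\cdot,\cdot]_E)$ is a local Lie algebra: $[\cdot,\cdot]_E$ is a Lie bracket on $\Gamma(E)$ with $\operatorname{supp}[u,v]_E\subset\operatorname{supp}u\cap\operatorname{supp}v$.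 -/

import Mathlib

open Bundle VectorField
open scoped Manifold ContDiff

noncomputable section

namespace GenCplx

section Basics

variable {EM : Type*} [NormedAddCommGroup EM] [NormedSpace ℝ EM]
  {H : Type*} [TopologicalSpace H] (I : ModelWithCorners ℝ EM H)
  {M : Type*} [TopologicalSpace M] [ChartedSpace H M] [IsManifold I ∞ M]
  (F : Type*) [NormedAddCommGroup F] [NormedSpace ℝ F]
  (E : M → Type*) [TopologicalSpace (TotalSpace F E)]
  [∀ x, TopologicalSpace (E x)] [∀ x, AddCommGroup (E x)] [∀ x, Module ℝ (E x)]
  [FiberBundle F E] [VectorBundle ℝ F E]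

/-- The space `Γ(E)` of smooth sections of a vector bundle `E` with model fibre `F`. -/
abbrev Sec : Type _ := Cₛ^∞⟮I; F, E⟯

variable {I F E} in
/-- The product `f u` of a smooth function and a smooth section. -/
def fsmul (f : C^∞⟮I, M; ℝ⟯) (u : Sec I F E) : Sec I F E :=
  ⟨fun x => f x • u x, ContMDiff.smul_section f.contMDiff u.contMDiff⟩

/-- The fibre at `x` of the gauge (Atiyah) Lie algebroid `𝔇E`, i.e. of the bundle of covariant
differential operators: pairs of a tangent vector `X` (the symbol) and a linear map
`δ : Γ(E) → E_x` such that `δ (f u) = f(x) δ(u) + X(f) u(x)`. -/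
def DE (x : M) : Submodule ℝ (TangentSpace I x × (Sec I F E →ₗ[ℝ] E x)) where
  carrier := {d | ∀ (f : C^∞⟮I, M; ℝ⟯) (u : Sec I F E),
    d.2 (fsmul f u) = f x • d.2 u + (mvfderiv I f x d.1) • u x}
  zero_mem' := by
    intro f u
    simp
  add_mem' := by
    intro d e hd he f u
    have h1 := hd f u
    have h2 := he f u
    simp only [Prod.snd_add, Prod.fst_add, LinearMap.add_apply, map_add, h1, h2, smul_add,
      add_smul]
    abel
  smul_mem' := by
    intro c d hd f u
    have h1 := hd f u
    simp only [Prod.smul_snd, Prod.smul_fst, LinearMap.smul_apply, map_smul, h1, smul_add,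
      smul_eq_mul, mul_smul]
    rw [smul_comm]

variable {I F E}

/-- The projection `𝕛 : 𝔇E → TM`. -/
def symb {x : M} (d : DE I F E x) : TangentSpace I x := d.1.1

/-- The value at `x` of the operator `d ∈ 𝔇_x E` applied to a section. -/
def appDE {x : M} (d : DE I F E x) (u : Sec I F E) : E x := d.1.2 u

/-- The inclusion `𝕚 : gl(E) → 𝔇E`, where `Φ` acts by `u ↦ Φ (u x)`. -/
def glIncl (x : M) (Φ : E x →ₗ[ℝ] E x) : DE I F E x :=
  ⟨(0, { toFun := fun u => Φ (u x)
         map_add' := fun u v => by simp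
         map_smul' := fun c u => by simp }), by
    intro f u
    simp [fsmul]⟩

/-- A family `δ_x ∈ 𝔇_x E` is a smooth section of `𝔇E` if its symbol is a smooth vector field and
it maps smooth sections of `E` to smooth sections of `E`. -/
structure IsSmoothDE (δ : ∀ x, DE I F E x) : Prop where
  symb_smooth : ContMDiff I (I.prod 𝓘(ℝ, EM)) ∞
    (fun x => TotalSpace.mk' EM (E := (TangentSpace I : M → Type _)) x (symb (δ x)))
  app_smooth : ∀ u : Sec I F E, ContMDiff I (I.prod 𝓘(ℝ, F)) ∞
    (fun x => TotalSpace.mk' F x (appDE (δ x) u))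

variable (I F E) in
/-- The space `Γ(𝔇E)` of smooth sections of `𝔇E`. -/
def SecDE : Type _ := {δ : ∀ x, DE I F E x // IsSmoothDE δ}

/-- The action of `Γ(𝔇E)` on `Γ(E)`. -/
def SecDE.act (δ : SecDE I F E) (u : Sec I F E) : Sec I F E :=
  ⟨fun x => appDE (δ.1 x) u, δ.2.app_smooth u⟩

/-- `η` is the commutator `[δ, ε]_𝔇`: its operator is the commutator of the operators of `δ` and
`ε`, and its symbol is the Lie bracket of their symbols. -/
structure IsCommutator (η δ ε : SecDE I F E) : Prop where
  act_eq : ∀ u, η.act u = δ.act (ε.act u) - ε.act (δ.act u)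
  symb_eq : ∀ x, symb (η.1 x) = mlieBracket I (fun y => symb (δ.1 y)) (fun y => symb (ε.1 y)) x

variable (I F E) in
/-- The fibre at `x` of the first jet bundle `𝔍E`, regarded as the `E`-dual of `𝔇E`:
`{ν ∈ Hom(𝔇_x E, E_x) | ν(Φ) = Φ(ν(id)) for all Φ ∈ gl(E_x)}`. -/
def JE (x : M) : Submodule ℝ (DE I F E x →ₗ[ℝ] E x) where
  carrier := {ν | ∀ Φ : E x →ₗ[ℝ] E x, ν (glIncl x Φ) = Φ (ν (glIncl x LinearMap.id))}
  zero_mem' := by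
    intro Φ
    simp
  add_mem' := by
    intro a b ha hb Φ
    simp only [LinearMap.add_apply, map_add, ha Φ, hb Φ]
  smul_mem' := by
    intro c a ha Φ
    simp only [LinearMap.smul_apply, map_smul, ha Φ]

/-- The value at `x` of the jet `𝕕u ∈ Γ(𝔍E)`, `(𝕕u)(δ) = δ(u)`. -/
def jetD (u : Sec I F E) (x : M) : JE I F E x :=
  ⟨{ toFun := fun d => appDE d u
     map_add' := fun _ _ => rfl
     map_smul' := fun _ _ => rfl }, fun _ => rfl⟩

/-- An alternating `ℝ`-bilinear bracket satisfying the Jacobi identity. -/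
structure IsLieBracket {W : Type*} [AddCommGroup W] [Module ℝ W] (br : W →ₗ[ℝ] W →ₗ[ℝ] W) :
    Prop where
  alt : ∀ u, br u u = 0
  jacobi : ∀ u v w, br u (br v w) + br v (br w u) + br w (br u v) = 0

/-- The support of a section. -/
def secSupport (u : Sec I F E) : Set M := closure {x | u x ≠ 0}

/-- A local Lie algebra structure on `E`: a Lie bracket on `Γ(E)` which is local, i.e.
`supp [u, v] ⊆ supp u ∩ supp v`. -/
structure IsLocalLieAlgebra (br : Sec I F E →ₗ[ℝ] Sec I F E →ₗ[ℝ] Sec I F E) : Prop where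
  isLie : IsLieBracket br
  isLocal : ∀ u v, secSupport (br u v) ⊆ secSupport u ∩ secSupport v

end Basics

section Bundles

variable {EM : Type*} [NormedAddCommGroup EM] [NormedSpace ℝ EM]
  {H : Type*} [TopologicalSpace H] (I : ModelWithCorners ℝ EM H)
  {M : Type*} [TopologicalSpace M] [ChartedSpace H M] [IsManifold I ∞ M]
  (F : Type*) [NormedAddCommGroup F] [NormedSpace ℝ F]
  (E : M → Type*) [TopologicalSpace (TotalSpace F E)]
  [∀ x, TopologicalSpace (E x)] [∀ x, AddCommGroup (E x)] [∀ x, Module ℝ (E x)]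
  [∀ x, IsTopologicalAddGroup (E x)] [∀ x, ContinuousSMul ℝ (E x)]
  [FiberBundle F E] [VectorBundle ℝ F E] [ContMDiffVectorBundle ∞ F E I]
  (FK : Type*) [NormedAddCommGroup FK] [NormedSpace ℝ FK]
  (K : M → Type*) [TopologicalSpace (TotalSpace FK K)]
  [∀ x, TopologicalSpace (K x)] [∀ x, AddCommGroup (K x)] [∀ x, Module ℝ (K x)]
  [∀ x, IsTopologicalAddGroup (K x)] [∀ x, ContinuousSMul ℝ (K x)]
  [FiberBundle FK K] [VectorBundle ℝ FK K] [ContMDiffVectorBundle ∞ FK K I]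

variable {I F E FK K} in
/-- A smooth section of the bundle `Hom(K, E)`, i.e. a smooth vector bundle map `K → E`, applied to
a smooth section. -/
def applySec (φ : Sec I (FK →L[ℝ] F) (fun x => K x →L[ℝ] E x)) (X : Sec I FK K) : Sec I F E :=
  ⟨fun x => φ x (X x), φ.contMDiff.clm_bundle_apply X.contMDiff⟩

variable {I F E FK K} in
/-- A smooth bilinear bundle map `K × K → E` applied to two smooth sections. -/
def applySec₂ (φ : Sec I (FK →L[ℝ] FK →L[ℝ] F) (fun x => K x →L[ℝ] K x →L[ℝ] E x))
    (X Y : Sec I FK K) : Sec I F E :=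
  ⟨fun x => φ x (X x) (Y x), φ.contMDiff.clm_bundle_apply₂ X.contMDiff Y.contMDiff⟩

variable {I F E} in
/-- `(E, [·,·], a)` is a Lie algebroid with anchor the smooth bundle map `a : E → TM`. -/
structure IsLieAlgebroid (br : Sec I F E →ₗ[ℝ] Sec I F E →ₗ[ℝ] Sec I F E)
    (a : Sec I (F →L[ℝ] EM) (fun x => E x →L[ℝ] TangentSpace I x)) : Prop where
  isLie : IsLieBracket br
  leibniz : ∀ (u v : Sec I F E) (f : C^∞⟮I, M; ℝ⟯) (x : M),
    br u (fsmul f v) x = f x • br u v x + (mvfderiv I f x (a x (u x))) • v x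
  anchor_br : ∀ (u v : Sec I F E) (x : M),
    a x (br u v x) = mlieBracket I (fun y => a y (u y)) (fun y => a y (v y)) x

/-- The pairing and anchor of an `E`-Courant algebroid `K`, with condition (EC-4). -/
structure PairedAnchored where
  /-- the `E`-valued pairing -/
  pair : Sec I (FK →L[ℝ] FK →L[ℝ] F) (fun x => K x →L[ℝ] K x →L[ℝ] E x)
  pair_symm : ∀ (x : M) (X Y : K x), pair x X Y = pair x Y X
  pair_nondeg : ∀ (x : M) (X : K x), (∀ Y : K x, pair x X Y = 0) → X = 0
  /-- the anchor `ρ : K → 𝔇E` -/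
  ρ : ∀ x, K x →ₗ[ℝ] DE I F E x
  ρ_smooth : ∀ X : Sec I FK K, IsSmoothDE (fun x => ρ x (X x))
  /-- (EC-4): `ρ^⋆(𝔍E) ⊆ K`, where `Y ∈ K` is identified with `X ↦ 2⟨X, Y⟩` in `Hom(K, E)` -/
  ec4 : ∀ (x : M) (ν : JE I F E x), ∃ Y : K x, ∀ X : K x, ν.1 (ρ x X) = (2 : ℝ) • pair x X Y

variable {I F E FK K}

namespace PairedAnchored

variable (C : PairedAnchored I F E FK K)

/-- The embedding `K ↪ Hom(K, E)`, `Y(X) = 2⟨X, Y⟩`. -/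
def flat (x : M) : K x →ₗ[ℝ] (K x →ₗ[ℝ] E x) :=
  LinearMap.mk₂ ℝ (fun Y X => (2 : ℝ) • C.pair x X Y)
    (by intros; simp) (by intro c Y X; simp [smul_smul, mul_comm]) (by intros; simp)
    (by intro c Y X; simp [smul_smul, mul_comm])

theorem flat_injective (x : M) : Function.Injective (C.flat x) := by
  rw [injective_iff_map_eq_zero]
  intro Y hY
  refine C.pair_nondeg x Y fun X => ?_
  have h := LinearMap.congr_fun hY X
  have h' : (2 : ℝ) • C.pair x X Y = 0 := h
  rw [C.pair_symm]
  exact (smul_eq_zero.mp h').resolve_left two_ne_zero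

/-- The `E`-dual map `ρ^⋆ : 𝔍E → Hom(K, E)`, `ρ^⋆(ν)(X) = ν(ρ(X))`, which takes values in the
image of `K`. -/
def ρDual (x : M) : JE I F E x →ₗ[ℝ] LinearMap.range (C.flat x) :=
  LinearMap.codRestrict _ ((LinearMap.lcomp ℝ (E x) (C.ρ x)).comp (JE I F E x).subtype) (by
    intro ν
    obtain ⟨Y, hY⟩ := C.ec4 x ν
    exact ⟨Y, LinearMap.ext fun X => (hY X).symm⟩)

/-- The map `ρ^⋆ : 𝔍E → K`, characterised by `2⟨ρ^⋆(ν), X⟩ = ν(ρ(X))`. -/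
def ρStar (x : M) : JE I F E x →ₗ[ℝ] K x :=
  (LinearEquiv.ofInjective (C.flat x) (C.flat_injective x)).symm.toLinearMap.comp (C.ρDual x)

/-- The anchor on sections, `Γ(K) → Γ(𝔇E)`. -/
def ρSec (X : Sec I FK K) : SecDE I F E := ⟨fun x => C.ρ x (X x), C.ρ_smooth X⟩

end PairedAnchored

variable (I F E FK K) in
/-- An `E`-Courant algebroid structure on the vector bundle `K`. -/
structure ECourantAlgebroid extends PairedAnchored I F E FK K where
  /-- the bracket of `Γ(K)` -/
  bracket : Sec I FK K →ₗ[ℝ] Sec I FK K →ₗ[ℝ] Sec I FK K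
  leibnizAlg : ∀ X Y Z, bracket X (bracket Y Z) = bracket (bracket X Y) Z + bracket Y (bracket X Z)
  ec1 : ∀ X Y, IsCommutator (toPairedAnchored.ρSec (bracket X Y))
    (toPairedAnchored.ρSec X) (toPairedAnchored.ρSec Y)
  ec2 : ∀ X x, bracket X X x = toPairedAnchored.ρStar x (jetD (applySec₂ pair X X) x)
  ec3 : ∀ X Y Z, (toPairedAnchored.ρSec X).act (applySec₂ pair Y Z) =
    applySec₂ pair (bracket X Y) Z + applySec₂ pair Y (bracket X Z)
  ec5 : ∀ x (ν : JE I F E x), ρ x (toPairedAnchored.ρStar x ν) = 0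

/-- A smooth bundle map `J : K → K` is a generalized complex structure. -/
structure IsGeneralizedComplex (C : ECourantAlgebroid I F E FK K)
    (J : Sec I (FK →L[ℝ] FK) (fun x => K x →L[ℝ] K x)) : Prop where
  sq : ∀ x (X : K x), J x (J x X) = -X
  orth : ∀ x (X Y : K x), C.pair x (J x X) (J x Y) = C.pair x X Y
  integrable : ∀ X Y : Sec I FK K,
    C.bracket (applySec J X) (applySec J Y) - C.bracket X Y
      - applySec J (C.bracket (applySec J X) Y + C.bracket X (applySec J Y)) = 0

/-- The value at `x` of `ρ (J (ρ^⋆ (𝕕u))) ∈ Γ(𝔇E)`. -/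
def gcOp (C : ECourantAlgebroid I F E FK K) (J : Sec I (FK →L[ℝ] FK) (fun x => K x →L[ℝ] K x))
    (u : Sec I F E) (x : M) : DE I F E x :=
  C.ρ x (J x (C.ρStar x (jetD u x)))

end Bundles

end GenCplx

end

open scoped Topology

set_option linter.unusedSectionVars false

noncomputable section

namespace GenCplx

section FunctionMultiples

variable {EM : Type*} [NormedAddCommGroup EM] [NormedSpace ℝ EM]
  {H : Type*} [TopologicalSpace H] {I : ModelWithCorners ℝ EM H}
  {M : Type*} [TopologicalSpace M] [ChartedSpace H M]
  {F : Type*} [NormedAddCommGroup F] [NormedSpace ℝ F]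
  {V : M → Type*} [TopologicalSpace (TotalSpace F V)]
  [∀ x, TopologicalSpace (V x)] [∀ x, AddCommGroup (V x)] [∀ x, Module ℝ (V x)]
  [FiberBundle F V] [VectorBundle ℝ F V]

/-! Write D u for the section ρ^⋆𝕕u of K (`dSec`), so that 2(X, D u) = ρ(X)u. Invariance of the
pairing and compatibility of the anchor with brackets give [X, D u] = D(ρ(X)u) (`bracket_dSec`). The
symmetric part of the bracket is D of the pairing, hence [D u, X] = 0 (`dSec_bracket`).
Integrability of J on the pair D u, D v therefore collapses to J D[u,v] = [J D u, J D v]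
(`applySec_dSec_gcBracket`). Applying ρ, the operator of [u,v] is the commutator of the operators of
u and v: on sections this is the Jacobi identity, on symbols the anchor identity. Skew-symmetry is
that of J.

The Leibniz rule in v holds because ρ(J D u) is a covariant differential operator; skew-symmetry
transfers it to u. Locality follows by cutting off. In rank at least 2, expanding [gu, fv] in both
orders forces the symbol to be C^∞-linear in u (`gcSymb_fsmul`), so it descends to a smooth bundle
map (`exists_anchor`). -/

theorem fsmul_apply (f : C^∞⟮I, M; ℝ⟯) (u : Sec I F V) (x : M) : fsmul f u x = f x • u x := rfl

end FunctionMultiples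

/-! ### Cutoffs, global extension of local sections, and C^∞-linear maps. -/

section SmoothExtension

variable {EM : Type*} [NormedAddCommGroup EM] [NormedSpace ℝ EM] [FiniteDimensional ℝ EM]
  {H : Type*} [TopologicalSpace H] {I : ModelWithCorners ℝ EM H}
  {M : Type*} [TopologicalSpace M] [T2Space M] [ChartedSpace H M] [IsManifold I ∞ M]
  {F : Type*} [NormedAddCommGroup F] [NormedSpace ℝ F]
  {V : M → Type*} [TopologicalSpace (TotalSpace F V)]
  [∀ x, TopologicalSpace (V x)] [∀ x, AddCommGroup (V x)] [∀ x, Module ℝ (V x)]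
  [FiberBundle F V] [VectorBundle ℝ F V]

variable (I) in
/-- Every neighbourhood of `x` supports a smooth function equal to `1` near `x`. -/
theorem exists_cutoff {x : M} {U : Set M} (hU : U ∈ 𝓝 x) :
    ∃ χ : C^∞⟮I, M; ℝ⟯, (∀ᶠ y in 𝓝 x, χ y = 1) ∧ tsupport χ ⊆ U := by
  obtain ⟨χ, -, hχ⟩ := (SmoothBumpFunction.nhds_basis_tsupport (I := I) x).mem_iff.mp hU
  exact ⟨⟨χ, χ.contMDiff⟩, χ.eventuallyEq_one, hχ⟩

/-- A section which is smooth on a neighbourhood of `x` agrees near `x` with a global section. -/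
theorem exists_sec_eventuallyEq {x : M} {σ : ∀ y, V y} {U : Set M} (hU : IsOpen U) (hx : x ∈ U)
    (hσ : ContMDiffOn I (I.prod 𝓘(ℝ, F)) ∞ (fun y => TotalSpace.mk' F y (σ y)) U) :
    ∃ s : Sec I F V, ∀ᶠ y in 𝓝 x, s y = σ y := by
  obtain ⟨χ, h1, hs⟩ := exists_cutoff I (hU.mem_nhds hx)
  refine ⟨⟨fun y => χ y • σ y, ?_⟩, ?_⟩
  · exact ContMDiffOn.smul_section_of_tsupport χ.contMDiff.contMDiffOn hU hs hσ
  · filter_upwards [h1] with y hy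
    change χ y • σ y = σ y
    rw [hy, one_smul]

/-- A function which is smooth on a neighbourhood of `x` agrees near `x` with a global smooth
function. -/
theorem exists_map_eventuallyEq {x : M} {f : M → ℝ} {U : Set M} (hU : IsOpen U) (hx : x ∈ U)
    (hf : ContMDiffOn I 𝓘(ℝ, ℝ) ∞ f U) :
    ∃ g : C^∞⟮I, M; ℝ⟯, ∀ᶠ y in 𝓝 x, g y = f y := by
  obtain ⟨χ, h1, hs⟩ := exists_cutoff I (hU.mem_nhds hx)
  refine ⟨⟨fun y => χ y • f y, contMDiff_of_tsupport fun y hy => ?_⟩, ?_⟩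
  · have hyU : y ∈ U := hs (tsupport_smul_subset_left _ _ hy)
    exact χ.contMDiff.contMDiffAt.smul ((hf y hyU).contMDiffAt (hU.mem_nhds hyU))
  · filter_upwards [h1] with y hy
    change χ y • f y = f y
    rw [hy, one_smul]

variable [ContMDiffVectorBundle ∞ F V I]

/-- Global sections which agree near `x` with the constant sections of a trivialization. -/
theorem exists_sec_eventuallyEq_symm (x : M) (v : F) :
    ∃ s : Sec I F V, ∀ᶠ y in 𝓝 x, s y = (trivializationAt F V x).symm y v := by
  refine exists_sec_eventuallyEq (trivializationAt F V x).open_baseSet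
    (FiberBundle.mem_baseSet_trivializationAt' x) ?_
  intro y hy
  rw [Trivialization.contMDiffWithinAt_section _ hy]
  refine (contMDiffWithinAt_const (c := v)).congr (fun z hz => ?_) ?_
  · simp [Trivialization.apply_mk_symm _ hz]
  · simp [Trivialization.apply_mk_symm _ hy]

variable (I) in
theorem exists_sec_apply_eq (x : M) (v : V x) : ∃ s : Sec I F V, s x = v := by
  obtain ⟨s, hs⟩ := exists_sec_eventuallyEq_symm (I := I) (V := V) x
    ((trivializationAt F V x) ⟨x, v⟩).2
  exact ⟨s, by rw [hs.self_of_nhds, Trivialization.symm_proj_apply _ ⟨x, v⟩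
    (FiberBundle.mem_baseSet_trivializationAt' x)]⟩

/-- A `C^∞`-linear map depends only on the value of the section at the point. -/
theorem eq_zero_of_apply_eq_zero [FiniteDimensional ℝ F] {A : Type*} [AddCommGroup A] [Module ℝ A]
    (x : M) (T : Sec I F V →ₗ[ℝ] A)
    (hT : ∀ (f : C^∞⟮I, M; ℝ⟯) (u : Sec I F V), T (fsmul f u) = f x • T u)
    (u : Sec I F V) (hu : u x = 0) : T u = 0 := by
  classical
  -- Locality: if w vanishes on U and χ is supported in U with χ(x) = 1, then χw = 0 while T(χw) = T
  -- w.
  have hloc : ∀ w : Sec I F V, (∀ᶠ y in 𝓝 x, w y = 0) → T w = 0 := by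
    intro w hw
    obtain ⟨χ, h1, hs⟩ := exists_cutoff I hw
    have h0 : fsmul χ w = 0 := by
      ext y
      rw [fsmul_apply]
      by_cases hy : y ∈ tsupport χ
      · have : w y = 0 := hs hy
        simp [this]
      · simp [image_eq_zero_of_notMem_tsupport hy]
    have h2 := hT χ w
    rw [h0, map_zero, h1.self_of_nhds, one_smul] at h2
    exact h2.symm
  set e := trivializationAt F V x
  have hx : x ∈ e.baseSet := FiberBundle.mem_baseSet_trivializationAt' x
  set b := Module.finBasis ℝ F
  choose s hs using fun i => exists_sec_eventuallyEq_symm (I := I) (V := V) x (b i)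
  have hc : ∀ i, ∃ g : C^∞⟮I, M; ℝ⟯, ∀ᶠ y in 𝓝 x,
      g y = e.localFrameCoeff I b i y (u y) := fun i =>
    exists_map_eventuallyEq e.open_baseSet hx
      (contMDiffOn_baseSet_localFrameCoeff b u.contMDiff.contMDiffOn i)
  choose c hc using hc
  -- Near x, u is the combination of the frame sections s i with coefficients c i, all extended
  -- globally; `hloc` makes the difference invisible to T.
  have key : T (u - ∑ i, fsmul (c i) (s i)) = 0 := by
    apply hloc
    filter_upwards [e.eventually_eq_localFrame_sum_coeff_smul (I := I) (s := u) b hx,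
      Filter.eventually_all.mpr hc, Filter.eventually_all.mpr hs,
      e.open_baseSet.mem_nhds hx] with y h1 h2 h3 hy
    have h4 : (u - ∑ i, fsmul (c i) (s i)) y = u y - ∑ i, c i y • s i y := by
      have : (∑ i, fsmul (c i) (s i)) y = ∑ i, c i y • s i y := by
        induction (Finset.univ : Finset (Fin (Module.finrank ℝ F))) using Finset.induction_on with
        | empty => rfl
        | insert i t hi ih => rw [Finset.sum_insert hi, Finset.sum_insert hi, ← ih]; rfl
      rw [← this]; rfl
    rw [h4, h1, sub_eq_zero]
    refine Finset.sum_congr rfl fun i _ => ?_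
    rw [h2 i, h3 i, e.localFrame_apply_of_mem_baseSet b hy]
    rfl
  rw [map_sub, map_sum, sub_eq_zero] at key
  rw [key]
  refine Finset.sum_eq_zero fun i _ => ?_
  rw [hT, (hc i).self_of_nhds, hu, map_zero, zero_smul]

end SmoothExtension

/-! ### Smoothness of bundle maps tested on sections. -/

section HomBundle

variable {EM : Type*} [NormedAddCommGroup EM] [NormedSpace ℝ EM]
  {H : Type*} [TopologicalSpace H] {I : ModelWithCorners ℝ EM H}
  {M : Type*} [TopologicalSpace M] [ChartedSpace H M]

/-- In finite dimension A is the sum of coord_i ⊗ A(b_i) over a basis, so smoothness of the finitely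
many A(b_i) suffices. -/
theorem contMDiffAt_clm_of_apply {F₁ : Type*} [NormedAddCommGroup F₁] [NormedSpace ℝ F₁]
    [FiniteDimensional ℝ F₁] {F₂ : Type*} [NormedAddCommGroup F₂] [NormedSpace ℝ F₂]
    {A : M → F₁ →L[ℝ] F₂} {x : M} (hA : ∀ v, ContMDiffAt I 𝓘(ℝ, F₂) ∞ (fun y => A y v) x) :
    ContMDiffAt I 𝓘(ℝ, F₁ →L[ℝ] F₂) ∞ A x := by
  set b := Module.finBasis ℝ F₁
  have h : A = fun y => ∑ i, ContinuousLinearMap.smulRightL ℝ F₁ F₂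
      (LinearMap.toContinuousLinearMap (b.coord i)) (A y (b i)) := by
    ext y v
    have hv : A y v = ∑ i, b.repr v i • A y (b i) := by
      simp_rw [← map_smul, ← map_sum, b.sum_repr]
    simpa using hv
  rw [h]
  refine contMDiffAt_finsetSum fun i _ => ?_
  exact (ContinuousLinearMap.contMDiff _).contMDiffAt.comp x (hA (b i))

variable [FiniteDimensional ℝ EM] [T2Space M] [IsManifold I ∞ M]
  {F : Type*} [NormedAddCommGroup F] [NormedSpace ℝ F]
  {E : M → Type*} [TopologicalSpace (TotalSpace F E)]
  [∀ x, TopologicalSpace (E x)] [∀ x, AddCommGroup (E x)] [∀ x, Module ℝ (E x)]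
  [∀ x, IsTopologicalAddGroup (E x)] [∀ x, ContinuousSMul ℝ (E x)]
  [FiberBundle F E] [VectorBundle ℝ F E]
  {FK : Type*} [NormedAddCommGroup FK] [NormedSpace ℝ FK] [FiniteDimensional ℝ FK]
  {K : M → Type*} [TopologicalSpace (TotalSpace FK K)]
  [∀ x, TopologicalSpace (K x)] [∀ x, AddCommGroup (K x)] [∀ x, Module ℝ (K x)]
  [FiberBundle FK K] [VectorBundle ℝ FK K] [ContMDiffVectorBundle ∞ FK K I]

/-- A family of linear maps which sends smooth sections to smooth sections is smooth. -/
theorem contMDiff_hom_of_apply (φ : ∀ x, K x →L[ℝ] E x)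
    (hφ : ∀ s : Sec I FK K, ContMDiff I (I.prod 𝓘(ℝ, F)) ∞
      (fun x => TotalSpace.mk' F x (φ x (s x)))) :
    ContMDiff I (I.prod 𝓘(ℝ, FK →L[ℝ] F)) ∞
      (fun x => TotalSpace.mk' (FK →L[ℝ] F) (E := fun x => K x →L[ℝ] E x) x (φ x)) := by
  intro x
  rw [contMDiffAt_hom_bundle]
  refine ⟨contMDiffAt_id, contMDiffAt_clm_of_apply fun v => ?_⟩
  obtain ⟨s, hs⟩ := exists_sec_eventuallyEq_symm (I := I) (V := K) x v
  have h := (contMDiffAt_section _).mp (hφ s x)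
  refine h.congr_of_eventuallyEq ?_
  filter_upwards [hs, (trivializationAt FK K x).open_baseSet.mem_nhds
      (FiberBundle.mem_baseSet_trivializationAt' x),
    (trivializationAt F E x).open_baseSet.mem_nhds
      (FiberBundle.mem_baseSet_trivializationAt' x)] with y h1 h2 h3
  rw [h1]
  rw [ContinuousLinearMap.inCoordinates_eq h2 h3]
  rfl

variable [FiniteDimensional ℝ F]

/-- A family of vectors is smooth if its image under a smooth fibrewise injective bundle map
`K → Hom(K, E)` is smooth. -/
theorem contMDiff_of_apply_injective
    (p : Sec I (FK →L[ℝ] FK →L[ℝ] F) (fun x => K x →L[ℝ] K x →L[ℝ] E x))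
    (hp : ∀ x, Function.Injective (p x)) (w : ∀ x, K x)
    (hw : ∀ s : Sec I FK K, ContMDiff I (I.prod 𝓘(ℝ, F)) ∞
      (fun x => TotalSpace.mk' F x (p x (w x) (s x)))) :
    ContMDiff I (I.prod 𝓘(ℝ, FK)) ∞ (fun x => TotalSpace.mk' FK x (w x)) := by
  intro x
  have hA := ((contMDiffAt_hom_bundle _).mp (p.contMDiff x)).2
  have hq := (contMDiffAt_section _).mp (contMDiff_hom_of_apply (fun x => p x (w x)) hw x)
  rw [contMDiffAt_section]
  set e := trivializationAt FK K x
  have hx : x ∈ e.baseSet := FiberBundle.mem_baseSet_trivializationAt' x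
  set e' := trivializationAt (FK →L[ℝ] F) (fun x => K x →L[ℝ] E x) x
  have hx' : x ∈ e'.baseSet := FiberBundle.mem_baseSet_trivializationAt' x
  set A : M → FK →L[ℝ] FK →L[ℝ] F := fun y =>
    ContinuousLinearMap.inCoordinates FK K (FK →L[ℝ] F) (fun x => K x →L[ℝ] E x) x y x y (p y)
  have hA' : ∀ y ∈ e.baseSet, y ∈ e'.baseSet → ∀ k : K y, A y (e ⟨y, k⟩).2 = (e' ⟨y, p y k⟩).2 := by
    intro y hy hy' k
    simp only [A]
    rw [ContinuousLinearMap.inCoordinates_eq hy hy']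
    simp [e, e', hy]
  have hinj : Function.Injective (A x) := by
    simp only [A]
    rw [ContinuousLinearMap.inCoordinates_eq hx hx']
    exact (e'.continuousLinearEquivAt ℝ x hx').injective.comp
      ((hp x).comp (e.continuousLinearEquivAt ℝ x hx).symm.injective)
  -- The map K → Hom(K, E) is injective but need not be surjective, so it is inverted through a left
  -- inverse L of its coordinate form at the single point x. Then B = L ∘ A is the identity at x,
  -- hence invertible nearby with smooth inverse, and w has coordinates B⁻¹ L applied to those of
  -- p(w).
  obtain ⟨L, hL⟩ := (A x).toLinearMap.exists_leftInverse_of_injective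
    (LinearMap.ker_eq_bot_of_injective hinj)
  have hL' : (LinearMap.toContinuousLinearMap L).comp (A x) = ContinuousLinearMap.id ℝ FK := by
    ext v
    exact LinearMap.congr_fun hL v
  set B : M → FK →L[ℝ] FK := fun y => (LinearMap.toContinuousLinearMap L).comp (A y)
  have hB : ContMDiffAt I 𝓘(ℝ, FK →L[ℝ] FK) ∞ B x := contMDiffAt_const.clm_comp hA
  have hBx : B x = ((ContinuousLinearEquiv.refl ℝ FK : FK ≃L[ℝ] FK) : FK →L[ℝ] FK) := hL'
  have hBinv : ContMDiffAt I 𝓘(ℝ, FK →L[ℝ] FK) ∞ (fun y => (B y).inverse) x := by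
    have h := contDiffAt_map_inverse (n := ∞) (ContinuousLinearEquiv.refl ℝ FK)
    rw [← hBx] at h
    exact h.contMDiffAt.comp x hB
  have hunit : ∀ᶠ y in 𝓝 x, (B y).IsInvertible := by
    have h := ContinuousLinearEquiv.nhds (ContinuousLinearEquiv.refl ℝ FK)
    rw [← hBx] at h
    exact hB.continuousAt h
  refine (hBinv.clm_apply ((contMDiffAt_const
    (c := LinearMap.toContinuousLinearMap L)).clm_apply hq)).congr_of_eventuallyEq ?_
  filter_upwards [hunit, e.open_baseSet.mem_nhds hx, e'.open_baseSet.mem_nhds hx']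
    with y h1 h2 h3
  rw [← hA' y h2 h3]
  change _ = (B y).inverse (B y _)
  exact (h1.inverse_apply_self _).symm

end HomBundle

/-! ### Linearity of covariant operators and of jets. -/

section CovariantOperators

variable {EM : Type*} [NormedAddCommGroup EM] [NormedSpace ℝ EM]
  {H : Type*} [TopologicalSpace H] {I : ModelWithCorners ℝ EM H}
  {M : Type*} [TopologicalSpace M] [ChartedSpace H M] [IsManifold I ∞ M]
  {F : Type*} [NormedAddCommGroup F] [NormedSpace ℝ F]
  {E : M → Type*} [TopologicalSpace (TotalSpace F E)]
  [∀ x, TopologicalSpace (E x)] [∀ x, AddCommGroup (E x)] [∀ x, Module ℝ (E x)]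
  [FiberBundle F E] [VectorBundle ℝ F E]

theorem SecDE.act_add (δ : SecDE I F E) (u v : Sec I F E) : δ.act (u + v) = δ.act u + δ.act v :=
  ContMDiffSection.ext fun x => map_add (δ.1 x).1.2 u v

theorem SecDE.act_smul (δ : SecDE I F E) (c : ℝ) (u : Sec I F E) : δ.act (c • u) = c • δ.act u :=
  ContMDiffSection.ext fun x => map_smul (δ.1 x).1.2 c u

theorem SecDE.act_fsmul (δ : SecDE I F E) (f : C^∞⟮I, M; ℝ⟯) (u : Sec I F E) (x : M) :
    δ.act (fsmul f u) x = f x • δ.act u x + (mvfderiv I f x (symb (δ.1 x))) • u x :=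
  (δ.1 x).2 f u

theorem jetD_add (u v : Sec I F E) (x : M) : jetD (u + v) x = jetD u x + jetD v x :=
  Subtype.ext (LinearMap.ext fun d => map_add d.1.2 u v)

theorem jetD_smul (c : ℝ) (u : Sec I F E) (x : M) : jetD (c • u) x = c • jetD u x :=
  Subtype.ext (LinearMap.ext fun d => map_smul d.1.2 c u)

end CovariantOperators

/-! ### The Courant bracket on exact sections, and the bracket on Γ(E). -/

section CourantAlgebra

variable {EM : Type*} [NormedAddCommGroup EM] [NormedSpace ℝ EM] [FiniteDimensional ℝ EM]
  {H : Type*} [TopologicalSpace H] {I : ModelWithCorners ℝ EM H}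
  {M : Type*} [TopologicalSpace M] [T2Space M] [ChartedSpace H M] [IsManifold I ∞ M]
  {F : Type*} [NormedAddCommGroup F] [NormedSpace ℝ F] [FiniteDimensional ℝ F]
  {E : M → Type*} [TopologicalSpace (TotalSpace F E)]
  [∀ x, TopologicalSpace (E x)] [∀ x, AddCommGroup (E x)] [∀ x, Module ℝ (E x)]
  [∀ x, IsTopologicalAddGroup (E x)] [∀ x, ContinuousSMul ℝ (E x)]
  [FiberBundle F E] [VectorBundle ℝ F E] [ContMDiffVectorBundle ∞ F E I]
  {FK : Type*} [NormedAddCommGroup FK] [NormedSpace ℝ FK] [FiniteDimensional ℝ FK]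
  {K : M → Type*} [TopologicalSpace (TotalSpace FK K)]
  [∀ x, TopologicalSpace (K x)] [∀ x, AddCommGroup (K x)] [∀ x, Module ℝ (K x)]
  [∀ x, IsTopologicalAddGroup (K x)] [∀ x, ContinuousSMul ℝ (K x)]
  [FiberBundle FK K] [VectorBundle ℝ FK K] [ContMDiffVectorBundle ∞ FK K I]

namespace PairedAnchored

variable (C : PairedAnchored I F E FK K)

theorem two_smul_pair_ρStar (x : M) (X : K x) (ν : JE I F E x) :
    (2 : ℝ) • C.pair x X (C.ρStar x ν) = ν.1 (C.ρ x X) := by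
  have h : C.flat x (C.ρStar x ν) = (C.ρDual x ν : K x →ₗ[ℝ] E x) :=
    congrArg Subtype.val
      ((LinearEquiv.ofInjective (C.flat x) (C.flat_injective x)).apply_symm_apply (C.ρDual x ν))
  exact LinearMap.congr_fun h X

theorem pair_injective (x : M) : Function.Injective (C.pair x) := by
  rw [injective_iff_map_eq_zero]
  intro X hX
  exact C.pair_nondeg x X fun Y => by rw [hX]; rfl

/-- The section `ρ^⋆(𝕕u)` of `K`. -/
def dSec (u : Sec I F E) : Sec I FK K :=
  ⟨fun x => C.ρStar x (jetD u x), by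
    -- ρ^⋆ is defined fibre by fibre, so smoothness must be proved: the pairing of ρ^⋆𝕕u with a
    -- section s is ½ρ(s)u, which is smooth.
    refine contMDiff_of_apply_injective C.pair C.pair_injective _ fun s => ?_
    have h := ((2 : ℝ)⁻¹ • (C.ρSec s).act u).contMDiff
    refine h.congr fun x => ?_
    congr 1
    rw [C.pair_symm, eq_comm]
    change (2 : ℝ)⁻¹ • (jetD u x).1 (C.ρ x (s x)) = _
    rw [← C.two_smul_pair_ρStar, smul_smul, inv_mul_cancel₀ two_ne_zero, one_smul]⟩

theorem dSec_add (u v : Sec I F E) : C.dSec (u + v) = C.dSec u + C.dSec v :=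
  ContMDiffSection.ext fun x => by
    change C.ρStar x (jetD (u + v) x) = C.ρStar x (jetD u x) + C.ρStar x (jetD v x)
    rw [jetD_add, map_add]

theorem dSec_smul (c : ℝ) (u : Sec I F E) : C.dSec (c • u) = c • C.dSec u :=
  ContMDiffSection.ext fun x => by
    change C.ρStar x (jetD (c • u) x) = c • C.ρStar x (jetD u x)
    rw [jetD_smul, map_smul]

theorem two_smul_pair_dSec (X : Sec I FK K) (u : Sec I F E) :
    (2 : ℝ) • applySec₂ C.pair X (C.dSec u) = (C.ρSec X).act u :=
  ContMDiffSection.ext fun x => C.two_smul_pair_ρStar x (X x) (jetD u x)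

theorem two_smul_pair_dSec_left (X : Sec I FK K) (u : Sec I F E) :
    (2 : ℝ) • applySec₂ C.pair (C.dSec u) X = (C.ρSec X).act u := by
  rw [← C.two_smul_pair_dSec]
  congr 1
  exact ContMDiffSection.ext fun x => C.pair_symm x _ _

theorem ext_of_pair {X Y : Sec I FK K}
    (h : ∀ Z, (2 : ℝ) • applySec₂ C.pair X Z = (2 : ℝ) • applySec₂ C.pair Y Z) : X = Y := by
  ext x
  refine C.pair_injective x (ContinuousLinearMap.ext fun z => ?_)
  obtain ⟨Z, rfl⟩ := exists_sec_apply_eq (F := FK) I x z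
  exact smul_right_injective _ (two_ne_zero (α := ℝ)) (DFunLike.congr_fun (h Z) x)

theorem act_ρSec_add (X Y : Sec I FK K) (u : Sec I F E) :
    (C.ρSec (X + Y)).act u = (C.ρSec X).act u + (C.ρSec Y).act u :=
  ContMDiffSection.ext fun x => by
    change appDE (C.ρ x (X x + Y x)) u = appDE (C.ρ x (X x)) u + appDE (C.ρ x (Y x)) u
    rw [map_add]; rfl

theorem act_ρSec_smul (c : ℝ) (X : Sec I FK K) (u : Sec I F E) :
    (C.ρSec (c • X)).act u = c • (C.ρSec X).act u :=
  ContMDiffSection.ext fun x => by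
    change appDE (C.ρ x (c • X x)) u = c • appDE (C.ρ x (X x)) u
    rw [map_smul]; rfl

end PairedAnchored

namespace ECourantAlgebroid

variable (C : ECourantAlgebroid I F E FK K)

theorem bracket_self (X : Sec I FK K) : C.bracket X X = C.dSec (applySec₂ C.pair X X) :=
  ContMDiffSection.ext fun x => C.ec2 X x

/-- Polarization of `bracket_self`. -/
theorem bracket_add_bracket_swap (X Y : Sec I FK K) :
    C.bracket X Y + C.bracket Y X = C.dSec ((2 : ℝ) • applySec₂ C.pair X Y) := by
  have h := C.bracket_self (X + Y)
  have hP : applySec₂ C.pair (X + Y) (X + Y)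
      = applySec₂ C.pair X X + (2 : ℝ) • applySec₂ C.pair X Y + applySec₂ C.pair Y Y := by
    ext x
    change C.pair x (X x + Y x) (X x + Y x)
      = C.pair x (X x) (X x) + (2 : ℝ) • C.pair x (X x) (Y x) + C.pair x (Y x) (Y x)
    simp only [map_add, add_apply, C.pair_symm x (Y x) (X x)]
    module
  rw [hP, C.dSec_add, C.dSec_add, ← C.bracket_self, ← C.bracket_self] at h
  simp only [map_add, LinearMap.add_apply] at h
  have h2 : ∀ a b c d e : Sec I FK K, a + b + (c + d) = a + e + d → b + c = e := by
    intro a b c d e h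
    have : b + c = (a + b + (c + d)) - a - d := by abel
    rw [this, h]; abel
  rw [add_comm]
  exact h2 _ _ _ _ _ h

/-- `[X, ρ^⋆(𝕕u)] = ρ^⋆(𝕕(ρ(X)u))`. -/
theorem bracket_dSec (X : Sec I FK K) (u : Sec I F E) :
    C.bracket X (C.dSec u) = C.dSec ((C.ρSec X).act u) := by
  refine C.ext_of_pair fun Z => ?_
  have h3 := C.ec3 X (C.dSec u) Z
  have h1 := (C.ec1 X Z).act_eq u
  have h : applySec₂ C.pair (C.bracket X (C.dSec u)) Z
      = (C.ρSec X).act (applySec₂ C.pair (C.dSec u) Z)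
        - applySec₂ C.pair (C.dSec u) (C.bracket X Z) := by
    rw [h3]; abel
  -- Twice the pairing with Z is ρ(X)ρ(Z)u − ρ([X,Z])u = ρ(Z)ρ(X)u, which is also 2(D(ρ(X)u), Z).
  rw [h, smul_sub, ← SecDE.act_smul, C.two_smul_pair_dSec_left, C.two_smul_pair_dSec_left,
    C.two_smul_pair_dSec_left, h1]
  abel

/-- `[ρ^⋆(𝕕u), X] = 0`. -/
theorem dSec_bracket (X : Sec I FK K) (u : Sec I F E) : C.bracket (C.dSec u) X = 0 := by
  -- The symmetric part D(2(X, D u)) = D(ρ(X)u) is already all of [X, D u].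
  have h := C.bracket_add_bracket_swap X (C.dSec u)
  rw [C.two_smul_pair_dSec, C.bracket_dSec] at h
  simpa using h

/-- The bilinear map `(u, v) ↦ ρ(J(ρ^⋆(𝕕u)))v`. -/
def gcBracket (J : Sec I (FK →L[ℝ] FK) (fun x => K x →L[ℝ] K x)) :
    Sec I F E →ₗ[ℝ] Sec I F E →ₗ[ℝ] Sec I F E :=
  LinearMap.mk₂ ℝ (fun u v => (C.ρSec (applySec J (C.dSec u))).act v)
    (fun u u' v => by
      have h : applySec J (C.dSec (u + u')) = applySec J (C.dSec u) + applySec J (C.dSec u') := by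
        rw [C.dSec_add]
        exact ContMDiffSection.ext fun x => map_add (J x) _ _
      rw [h, C.act_ρSec_add])
    (fun c u v => by
      have h : applySec J (C.dSec (c • u)) = c • applySec J (C.dSec u) := by
        rw [C.dSec_smul]
        exact ContMDiffSection.ext fun x => map_smul (J x) _ _
      rw [h, C.act_ρSec_smul])
    (fun u v v' => SecDE.act_add _ _ _)
    (fun c u v => SecDE.act_smul _ _ _)

variable {C} {J : Sec I (FK →L[ℝ] FK) (fun x => K x →L[ℝ] K x)}

theorem gcBracket_apply (u v : Sec I F E) :
    C.gcBracket J u v = (C.ρSec (applySec J (C.dSec u))).act v := rfl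

theorem gcBracket_apply_apply (u v : Sec I F E) (x : M) :
    C.gcBracket J u v x = appDE (gcOp C J u x) v := rfl

theorem gcBracket_eq_pair (u v : Sec I F E) (x : M) :
    C.gcBracket J u v x =
      (2 : ℝ) • C.pair x (J x (C.ρStar x (jetD u x))) (C.ρStar x (jetD v x)) :=
  (C.two_smul_pair_ρStar x _ (jetD v x)).symm

theorem gcBracket_fsmul_right (u v : Sec I F E) (f : C^∞⟮I, M; ℝ⟯) (x : M) :
    C.gcBracket J u (fsmul f v) x =
      f x • C.gcBracket J u v x + (mvfderiv I f x (symb (gcOp C J u x))) • v x :=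
  SecDE.act_fsmul _ f v x

variable (hJ : IsGeneralizedComplex C J)
include hJ

/-- Orthogonality together with J² = −1 makes J skew: (J D, D) = (J J D, J D) = −(D, J D). -/
theorem gcBracket_self (u : Sec I F E) : C.gcBracket J u u = 0 := by
  ext x
  rw [gcBracket_eq_pair]
  set D := C.ρStar x (jetD u x)
  have h := hJ.orth x (J x D) D
  rw [hJ.sq, map_neg, neg_apply, C.pair_symm x D] at h
  change (2 : ℝ) • C.pair x (J x D) D = 0
  rw [two_smul]
  nth_rewrite 1 [← h]
  exact neg_add_cancel _

theorem gcBracket_swap (u v : Sec I F E) : C.gcBracket J u v = -C.gcBracket J v u :=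
  (LinearMap.IsAlt.neg (gcBracket_self hJ) v u).symm

/-- Integrability of `J` on exact sections: `J(ρ^⋆(𝕕[u, v])) = [J(ρ^⋆(𝕕u)), J(ρ^⋆(𝕕v))]`. -/
theorem applySec_dSec_gcBracket (u v : Sec I F E) :
    applySec J (C.dSec (C.gcBracket J u v)) =
      C.bracket (applySec J (C.dSec u)) (applySec J (C.dSec v)) := by
  have h := hJ.integrable (C.dSec u) (C.dSec v)
  rw [C.dSec_bracket, C.dSec_bracket, C.bracket_dSec, sub_zero, add_zero, sub_eq_zero] at h
  exact h.symm

/-- The anchor turns [J D u, J D v] = J D[u,v] into [[u,v],w] = [u,[v,w]] − [v,[u,w]]; skew-symmetry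
puts this in cyclic form. -/
theorem isLieBracket_gcBracket : IsLieBracket (C.gcBracket J) where
  alt := gcBracket_self hJ
  jacobi u v w := by
    have h := (C.ec1 (applySec J (C.dSec u)) (applySec J (C.dSec v))).act_eq w
    rw [← applySec_dSec_gcBracket hJ] at h
    simp only [← gcBracket_apply] at h
    rw [gcBracket_swap hJ w (C.gcBracket J u v), h, gcBracket_swap hJ w u, map_neg]
    abel

theorem symb_gcOp_gcBracket (u v : Sec I F E) (x : M) :
    symb (gcOp C J (C.gcBracket J u v) x) =
      mlieBracket I (fun y => symb (gcOp C J u y)) (fun y => symb (gcOp C J v y)) x := by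
  have h := (C.ec1 (applySec J (C.dSec u)) (applySec J (C.dSec v))).symb_eq x
  rw [← applySec_dSec_gcBracket hJ] at h
  exact h

theorem secSupport_gcBracket_subset (u v : Sec I F E) :
    secSupport (C.gcBracket J u v) ⊆ secSupport u ∩ secSupport v := by
  have h : ∀ u v : Sec I F E, secSupport (C.gcBracket J u v) ⊆ secSupport v := by
    intro u v
    refine closure_minimal (fun x hx => ?_) isClosed_closure
    by_contra hv
    -- With χ = 1 near x and supported off supp v, χv = 0. In the Leibniz rule for [u, χv] at x the
    -- derivative term dies because v(x) = 0, leaving [u,v](x) = 0.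
    obtain ⟨χ, h1, hs⟩ := exists_cutoff I (isClosed_closure.isOpen_compl.mem_nhds hv)
    have h0 : fsmul χ v = 0 := by
      ext y
      rw [fsmul_apply]
      by_cases hy : y ∈ tsupport χ
      · have : v y = 0 := not_not.mp fun hn => hs hy (subset_closure hn)
        simp [this]
      · simp [image_eq_zero_of_notMem_tsupport hy]
    have hvx : v x = 0 := not_not.mp fun hn => hv (subset_closure hn)
    have h2 := gcBracket_fsmul_right (C := C) (J := J) u v χ x
    rw [h0, map_zero, h1.self_of_nhds, one_smul, hvx, smul_zero, add_zero] at h2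
    exact hx h2.symm
  refine Set.subset_inter ?_ (h u v)
  have h' : secSupport (C.gcBracket J u v) = secSupport (C.gcBracket J v u) := by
    rw [gcBracket_swap hJ]
    simp [secSupport]
  rw [h']
  exact h v u

end ECourantAlgebroid

end CourantAlgebra

/-! ### Descent of the symbol to an anchor E → TM. -/

section Anchor

variable {EM : Type*} [NormedAddCommGroup EM] [NormedSpace ℝ EM] [FiniteDimensional ℝ EM]
  {H : Type*} [TopologicalSpace H] {I : ModelWithCorners ℝ EM H}
  {M : Type*} [TopologicalSpace M] [T2Space M] [ChartedSpace H M] [IsManifold I ∞ M]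

/-- Smooth functions separate tangent vectors. -/
theorem tangent_ext {x : M} {X Y : TangentSpace I x}
    (h : ∀ f : C^∞⟮I, M; ℝ⟯, mvfderiv I f x X = mvfderiv I f x Y) : X = Y := by
  have hinj : Function.Injective (mfderiv I 𝓘(ℝ, EM) (extChartAt I x) x) :=
    (isInvertible_mfderiv_extChartAt (mem_extChartAt_source x)).injective
  apply hinj
  have hsep : ∀ v w : EM, (∀ ℓ : EM →L[ℝ] ℝ, ℓ v = ℓ w) → v = w := by
    intro v w h
    by_contra hne
    obtain ⟨ℓ, hℓ⟩ := SeparatingDual.exists_separating_of_ne (R := ℝ) hne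
    exact hℓ (h ℓ)
  refine hsep _ _ fun ℓ => ?_
  -- The test functions are linear functionals of the chart at x, extended globally from a
  -- neighbourhood of x.
  obtain ⟨f, hf⟩ := exists_map_eventuallyEq (I := I) (x := x) (f := ℓ ∘ extChartAt I x)
    (chartAt H x).open_source (mem_chart_source H x)
    (ℓ.contMDiff.comp_contMDiffOn contMDiffOn_extChartAt)
  have hd : ∀ Z : TangentSpace I x,
      mvfderiv I f x Z = ℓ (mfderiv I 𝓘(ℝ, EM) (extChartAt I x) x Z) := by
    intro Z
    have h1 : mvfderiv I f x Z = mvfderiv I (ℓ ∘ extChartAt I x) x Z := by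
      have : mfderiv I 𝓘(ℝ, ℝ) f x = mfderiv I 𝓘(ℝ, ℝ) (ℓ ∘ extChartAt I x) x :=
        Filter.EventuallyEq.mfderiv_eq hf
      exact congrArg (fun A : EM →L[ℝ] ℝ => A Z) this
    rw [h1, mvfderiv_comp_apply x ℓ.mdifferentiableAt
      (mdifferentiableAt_extChartAt (mem_chart_source H x))]
    change mfderiv 𝓘(ℝ, EM) 𝓘(ℝ, ℝ) ℓ _ _ = _
    rw [ℓ.mfderiv_eq]
    rfl
  rw [← hd, ← hd]
  exact h f

variable {F : Type*} [NormedAddCommGroup F] [NormedSpace ℝ F] [FiniteDimensional ℝ F]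
  {E : M → Type*} [TopologicalSpace (TotalSpace F E)]
  [∀ x, TopologicalSpace (E x)] [∀ x, AddCommGroup (E x)] [∀ x, Module ℝ (E x)]
  [∀ x, IsTopologicalAddGroup (E x)] [∀ x, ContinuousSMul ℝ (E x)]
  [FiberBundle F E] [VectorBundle ℝ F E] [ContMDiffVectorBundle ∞ F E I]

/-- A linear operator from sections to vector fields which is `C^∞`-linear and preserves
smoothness is induced by a smooth bundle map. -/
theorem exists_anchor (T : ∀ x, Sec I F E →ₗ[ℝ] TangentSpace I x)
    (hT : ∀ x (f : C^∞⟮I, M; ℝ⟯) (u : Sec I F E), T x (fsmul f u) = f x • T x u)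
    (hsm : ∀ u : Sec I F E, ContMDiff I (I.prod 𝓘(ℝ, EM)) ∞
      (fun x => TotalSpace.mk' EM (E := (TangentSpace I : M → Type _)) x (T x u))) :
    ∃ a : Sec I (F →L[ℝ] EM) (fun x => E x →L[ℝ] TangentSpace I x),
      ∀ u x, a x (u x) = T x u := by
  have key : ∀ x, ∃ A : E x →L[ℝ] TangentSpace I x, ∀ u : Sec I F E, A (u x) = T x u := by
    intro x
    have : T2Space (E x) := FiberBundle.t2Space F E x
    have : FiniteDimensional ℝ (E x) := VectorBundle.finiteDimensional ℝ F E x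
    let ev : Sec I F E →ₗ[ℝ] E x :=
      { toFun := fun u => u x, map_add' := fun _ _ => rfl, map_smul' := fun _ _ => rfl }
    -- g chooses, linearly, a section through each vector of the fibre; T ∘ g does not depend on the
    -- choice since T x kills sections vanishing at x.
    obtain ⟨g, hg⟩ := ev.exists_rightInverse_of_surjective
      (LinearMap.range_eq_top.mpr (exists_sec_apply_eq (F := F) I x))
    refine ⟨LinearMap.toContinuousLinearMap ((T x).comp g), fun u => ?_⟩
    change T x (g (u x)) = T x u
    rw [← sub_eq_zero, ← map_sub]
    refine eq_zero_of_apply_eq_zero x (T x) (hT x) _ ?_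
    change g (u x) x - u x = 0
    rw [sub_eq_zero]
    exact LinearMap.congr_fun hg (u x)
  choose A hA using key
  refine ⟨⟨A, contMDiff_hom_of_apply A fun s => ?_⟩, fun u x => hA x u⟩
  simp only [hA]
  exact hsm s

variable {FK : Type*} [NormedAddCommGroup FK] [NormedSpace ℝ FK] [FiniteDimensional ℝ FK]
  {K : M → Type*} [TopologicalSpace (TotalSpace FK K)]
  [∀ x, TopologicalSpace (K x)] [∀ x, AddCommGroup (K x)] [∀ x, Module ℝ (K x)]
  [∀ x, IsTopologicalAddGroup (K x)] [∀ x, ContinuousSMul ℝ (K x)]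
  [FiberBundle FK K] [VectorBundle ℝ FK K] [ContMDiffVectorBundle ∞ FK K I]
  {C : ECourantAlgebroid I F E FK K} {J : Sec I (FK →L[ℝ] FK) (fun x => K x →L[ℝ] K x)}

namespace ECourantAlgebroid

variable (C J) in
/-- The map `u ↦ 𝕛ρJρ^⋆𝕕u` at the point `x`. -/
def gcSymb (x : M) : Sec I F E →ₗ[ℝ] TangentSpace I x where
  toFun u := symb (gcOp C J u x)
  map_add' u v := by
    simp only [gcOp, jetD_add, map_add]
    rfl
  map_smul' c u := by
    simp only [gcOp, jetD_smul, map_smul]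
    rfl

theorem gcBracket_fsmul_left (hJ : IsGeneralizedComplex C J) (u v : Sec I F E)
    (f : C^∞⟮I, M; ℝ⟯) (x : M) :
    C.gcBracket J (fsmul f u) v x =
      f x • C.gcBracket J u v x - (mvfderiv I f x (gcSymb C J x v)) • u x := by
  rw [gcBracket_swap hJ, gcBracket_swap hJ u v]
  change -(C.gcBracket J v (fsmul f u) x) = f x • -(C.gcBracket J v u x) - _
  rw [gcBracket_fsmul_right]
  change -(_ + (mvfderiv I f x (gcSymb C J x v)) • u x) = _
  rw [smul_neg]
  abel

/-- In rank at least two, the symbol of `ρJρ^⋆𝕕u` is `C^∞`-linear in `u`. -/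
theorem gcSymb_fsmul (hJ : IsGeneralizedComplex C J) (hF : 2 ≤ Module.finrank ℝ F) (x : M)
    (g : C^∞⟮I, M; ℝ⟯) (u : Sec I F E) :
    gcSymb C J x (fsmul g u) = g x • gcSymb C J x u := by
  -- Rank at least 2 enters here: the line (or zero space) spanned by u(x) is not the whole fibre.
  obtain ⟨w, hw⟩ : ∃ w : E x, w ∉ Submodule.span ℝ {u x} := by
    by_contra! h
    have h1 : Module.finrank ℝ (E x) = Module.finrank ℝ F :=
      (VectorBundle.continuousLinearEquivAt ℝ F E x).toLinearEquiv.finrank_eq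
    have h2 : Submodule.span ℝ {u x} = ⊤ := Submodule.eq_top_iff'.mpr h
    have h3 := finrank_span_le_card (R := ℝ) ({u x} : Set (E x))
    rw [h2, finrank_top, h1] at h3
    simp at h3
    omega
  obtain ⟨v, rfl⟩ := exists_sec_apply_eq (F := F) I x w
  refine tangent_ext fun f => ?_
  have h1 := gcBracket_fsmul_right (C := C) (J := J) (fsmul g u) v f x
  rw [gcBracket_fsmul_left hJ, gcBracket_fsmul_left hJ, gcBracket_fsmul_right] at h1
  change g x • (f x • C.gcBracket J u v x + mvfderiv I f x (gcSymb C J x u) • v x)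
      - mvfderiv I g x (gcSymb C J x (fsmul f v)) • u x
    = f x • (g x • C.gcBracket J u v x - mvfderiv I g x (gcSymb C J x v) • u x)
      + mvfderiv I f x (gcSymb C J x (fsmul g u)) • v x at h1
  set α := mvfderiv I f x (gcSymb C J x u)
  set β := mvfderiv I f x (gcSymb C J x (fsmul g u))
  set γ := mvfderiv I g x (gcSymb C J x (fsmul f v))
  set δ := mvfderiv I g x (gcSymb C J x v)
  -- The terms in fg[u,v] cancel between the two expansions of [gu, fv]. Since v(x) is not a
  -- multiple of u(x), the coefficient β − gα must vanish.
  have h2 : (β - g x * α) • v x = (f x * δ - γ) • u x := by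
    rw [← sub_eq_zero] at h1 ⊢
    rw [← neg_eq_zero, ← h1]
    module
  rw [map_smul, smul_eq_mul]
  by_contra hne
  apply hw
  rw [Submodule.mem_span_singleton]
  refine ⟨(β - g x * α)⁻¹ * (f x * δ - γ), ?_⟩
  rw [mul_smul, ← h2, smul_smul, inv_mul_cancel₀ (sub_ne_zero.mpr hne), one_smul]

theorem exists_isLieAlgebroid_gcBracket (hJ : IsGeneralizedComplex C J)
    (hF : 2 ≤ Module.finrank ℝ F) :
    ∃ a : Sec I (F →L[ℝ] EM) (fun x => E x →L[ℝ] TangentSpace I x),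
      (∀ u x, a x (u x) = symb (gcOp C J u x)) ∧ IsLieAlgebroid (C.gcBracket J) a := by
  obtain ⟨a, ha⟩ := exists_anchor (gcSymb C J) (gcSymb_fsmul hJ hF)
    (fun u => (C.ρ_smooth (applySec J (C.dSec u))).symb_smooth)
  have ha' : ∀ (u : Sec I F E) x, a x (u x) = symb (gcOp C J u x) := ha
  refine ⟨a, ha', isLieBracket_gcBracket hJ, fun u v f x => ?_, fun u v x => ?_⟩
  · rw [ha', gcBracket_fsmul_right]
  · simp only [ha']
    exact symb_gcOp_gcBracket hJ u v x

end ECourantAlgebroid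

end Anchor

end GenCplx

end

theorem mainTheorem3
    {EM : Type*} [NormedAddCommGroup EM] [NormedSpace ℝ EM] [FiniteDimensional ℝ EM]
    {M : Type*} [TopologicalSpace M] [T2Space M] [SecondCountableTopology M]
    [ChartedSpace EM M] [IsManifold 𝓘(ℝ, EM) ∞ M]
    {F : Type*} [NormedAddCommGroup F] [NormedSpace ℝ F] [FiniteDimensional ℝ F]
    {E : M → Type*} [TopologicalSpace (TotalSpace F E)]
    [∀ x, TopologicalSpace (E x)] [∀ x, AddCommGroup (E x)] [∀ x, Module ℝ (E x)]
    [∀ x, IsTopologicalAddGroup (E x)] [∀ x, ContinuousSMul ℝ (E x)]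
    [FiberBundle F E] [VectorBundle ℝ F E] [ContMDiffVectorBundle ∞ F E 𝓘(ℝ, EM)]
    {FK : Type*} [NormedAddCommGroup FK] [NormedSpace ℝ FK] [FiniteDimensional ℝ FK]
    {K : M → Type*} [TopologicalSpace (TotalSpace FK K)]
    [∀ x, TopologicalSpace (K x)] [∀ x, AddCommGroup (K x)] [∀ x, Module ℝ (K x)]
    [∀ x, IsTopologicalAddGroup (K x)] [∀ x, ContinuousSMul ℝ (K x)]
    [FiberBundle FK K] [VectorBundle ℝ FK K] [ContMDiffVectorBundle ∞ FK K 𝓘(ℝ, EM)]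
    (C : GenCplx.ECourantAlgebroid 𝓘(ℝ, EM) F E FK K)
    (J : GenCplx.Sec 𝓘(ℝ, EM) (FK →L[ℝ] FK) (fun x => K x →L[ℝ] K x))
    (hJ : GenCplx.IsGeneralizedComplex C J) :
    ∃ br : GenCplx.Sec 𝓘(ℝ, EM) F E →ₗ[ℝ] GenCplx.Sec 𝓘(ℝ, EM) F E →ₗ[ℝ]
        GenCplx.Sec 𝓘(ℝ, EM) F E,
      (∀ u v x, br u v x = (2 : ℝ) •
        C.pair x (J x (C.ρStar x (GenCplx.jetD u x))) (C.ρStar x (GenCplx.jetD v x))) ∧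
      (∀ u v x, br u v x = GenCplx.appDE (GenCplx.gcOp C J u x) v) ∧
      (∀ u, br u u = 0) ∧
      (2 ≤ Module.finrank ℝ F →
        ∃ a : GenCplx.Sec 𝓘(ℝ, EM) (F →L[ℝ] EM)
            (fun x => E x →L[ℝ] TangentSpace 𝓘(ℝ, EM) x),
          (∀ u x, a x (u x) = GenCplx.symb (GenCplx.gcOp C J u x)) ∧
          GenCplx.IsLieAlgebroid br a) ∧
      (Module.finrank ℝ F = 1 → GenCplx.IsLocalLieAlgebra br) :=
  ⟨C.gcBracket J, GenCplx.ECourantAlgebroid.gcBracket_eq_pair,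
    GenCplx.ECourantAlgebroid.gcBracket_apply_apply,
    GenCplx.ECourantAlgebroid.gcBracket_self hJ,
    GenCplx.ECourantAlgebroid.exists_isLieAlgebroid_gcBracket hJ,
    fun _ => ⟨GenCplx.ECourantAlgebroid.isLieBracket_gcBracket hJ,
      GenCplx.ECourantAlgebroid.secSupport_gcBracket_subset hJ⟩⟩
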